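/- **Setting.** $\lambda\mu$-terms, taken modulo renaming of bound variables, are given by $t ::= x \mid \lambda x\,t \mid (t)t \mid \mu\alpha[\beta]t$, where $x$ ranges over $\lambda$-variables and $\alpha,\beta$ over $\mu$-variables. An expression $[\beta]t$ is called a named term. A term is *normal* if no subterm can be reduced by one of the rules - $(\lambda x\,u)v\to u[v/x]$; - $(\mu\alpha\,u)v\to\mu\alpha\,u[v/{*}\alpha]$, where $u[v/{*}\alpha]$ is obtained from $u$ by inductively replacing each subterm $[\alpha]w$ by $[\alpha](w)v$; - $[\alpha]\mu\beta\,u\to u[\alpha/\beta]$; - $\mu\alpha[\alpha]u\to u$ if $\alpha$ is not free in $u$; - $\mu\alpha\,u\to\lambda x\,\mu\alpha\,u[x/{*}\alpha]$ if the named term $u$ has a subterm of the form $[\alpha]\lambda y\,w$. Types are second-order formulas built with $\bot,\to,\forall x,\forall X$ over a first-order language containing a constant $0$ and a unary function symbol $s$. Let $E$ be a set of equations between individual terms, and write $\vdash_E a=b$ if $a=b$ is a consequence of $E$. Assume that $E$ is adequate for the type of integers: for all terms $a,b$, $\nvdash_E s(a)=0$, and $\vdash_E s(a)=s(b)$ implies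 $\vdash_E a=b$. The judgement $\Gamma\vdash t:A,\Delta$, where $\Gamma$ assigns formulas to $\lambda$-variables and $\Delta$ to $\mu$-variables, is given by the rules 1. $\Gamma\vdash x:A,\Delta$ if $x:A$ is in $\Gamma$; 2. if $\Gamma,x:A\vdash t:B,\Delta$, then $\Gamma\vdash\lambda x\,t:A\to B,\Delta$; 3. if $\Gamma\vdash u:A\to B,\Delta$ and $\Gamma\vdash v:A,\Delta$, then $\Gamma\vdash (u)v:B,\Delta$; 4. introduction of $\forall x$ and of $\forall X$, for a variable that is not free in $\Gamma,\Delta$; 5. elimination of $\forall x$ (instantiation by any individual term) and of $\forall X$ (instantiation by any formula); 6. if $\Gamma\vdash t:A[a/x],\Delta$ and $\vdash_E a=b$, then $\Gamma\vdash t:A[b/x],\Delta$; 7. if $\Gamma\vdash t:A,\beta:B,\Delta$, then $\Gamma\vdash\mu\beta[\alpha]t:B,\alpha:A,\Delta$ if $\alpha\ne\beta$, and $\Gamma\vdash\mu\alpha[\alpha]t:B,\Delta$ if $\alpha=\beta$ (so that $A=B$). Put $N[a]=\forall X\{X(0)\to(\forall y(X(y)\to X(sy))\to X(a))\}$. A *classical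 integer of value $n$* is a closed term $\theta$ (without free $\lambda$- or $\mu$-variables) with $\vdash\theta:N[s^n(0)]$. For distinct $\lambda$-variables $x,f$, let $N_{x,f}$ be the least set of terms such that $x\in N_{x,f}$; $\mu\alpha[\beta]x\in N_{x,f}$; and if $u\in N_{x,f}$, then $(f)u\in N_{x,f}$ and $\mu\alpha[\beta](f)u\in N_{x,f}$ ($\alpha,\beta$ arbitrary $\mu$-variables, possibly equal). For $u\in N_{x,f}$ the set $\mathrm{val}(u)\subseteq\mathbb N$ is defined by $\mathrm{val}(x)=\{0\}$, $\mathrm{val}((f)u)=\{m+1: m\in\mathrm{val}(u)\}$, and $\mathrm{val}(\mu\alpha[\beta]u)=\bigcup\mathrm{val}(v)$, the union being over all subterms $[\alpha]v$ of $[\beta]u$. **Theorem.** Let $\theta$ be a normal classical integer of value $n$. Then $\theta=\lambda x\,\lambda f\,u$, where $u\in N_{x,f}$ has no free $\mu$-variables and $\mathrm{val}(u)=\{n\}$. Moreover, there is exactly one sequence $i_1,\dots,i_{m+1}$ ($m\ge 0$) of natural numbers for which there are bound $\mu$-variables $\alpha_1,\dots,\alpha_m$ of $u$ and subterms $\mu\alpha_j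 u_j$ of $u$ ($1\le j\le m$, each $u_j$ a named term) such that, writing $t_0=x$ and $t_j=\mu\alpha_j u_j$, the named term $[\alpha_j](f)^{i_j}t_{j-1}$ is a subterm of $u_j$ for $1\le j\le m$ and $u=(f)^{i_{m+1}}t_m$; and $i_1+\dots+i_{m+1}=n$. -/

import Mathlib

universe u v

namespace LamMu

/-! ### Pure λμ-terms

Terms are taken modulo renaming of bound variables, through de Bruijn indices: λ-variables and
μ-variables are indexed separately, `lam` binds λ-index `0` and `mu` binds μ-index `0`. -/

/-- `mu b t` is `μα[β]t`, where the name `β` is the μ-variable of index `b` counted inside the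
scope of `μα`; in particular `mu 0 t` is `μα[α]t`. -/
inductive Tm : Type
  | var (x : ℕ) : Tm
  | lam (t : Tm) : Tm
  | app (t u : Tm) : Tm
  | mu (b : ℕ) (t : Tm) : Tm

/-- A renaming carried under one binder. -/
def upRen (ρ : ℕ → ℕ) : ℕ → ℕ
  | 0 => 0
  | n + 1 => ρ n + 1

namespace Tm

/-- Renaming of the free λ-variables. -/
def renLam : (ℕ → ℕ) → Tm → Tm
  | ρ, var x => var (ρ x)
  | ρ, lam t => lam (renLam (upRen ρ) t)
  | ρ, app t w => app (renLam ρ t) (renLam ρ w)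
  | ρ, mu b t => mu b (renLam ρ t)

/-- Renaming of the free μ-variables. -/
def renMu : (ℕ → ℕ) → Tm → Tm
  | _, var x => var x
  | ρ, lam t => lam (renMu ρ t)
  | ρ, app t w => app (renMu ρ t) (renMu ρ w)
  | ρ, mu b t => mu (upRen ρ b) (renMu (upRen ρ) t)

/-- A substitution of λ-variables carried under a `lam`. -/
def upSub (σ : ℕ → Tm) : ℕ → Tm
  | 0 => var 0
  | n + 1 => (σ n).renLam Nat.succ

/-- Simultaneous capture-avoiding substitution of terms for the λ-variables. -/
def subst : (ℕ → Tm) → Tm → Tm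
  | σ, var x => σ x
  | σ, lam t => lam (subst (upSub σ) t)
  | σ, app t w => app (subst σ t) (subst σ w)
  | σ, mu b t => mu b (subst (fun x => (σ x).renMu Nat.succ) t)

/-- `u[v/x]`, where `x` is the λ-variable of index `0`, which disappears. -/
def inst (u v : Tm) : Tm :=
  subst (fun x => match x with
    | 0 => v
    | n + 1 => var n) u

/-- `strSub a v t` is `t[v/*α]`, where `α` is the free μ-variable of index `a`: every subterm
`[α]w` of `t` is replaced, inductively, by `[α](w)v`. -/
def strSub : ℕ → Tm → Tm → Tm
  | _, _, var x => var x
  | a, v, lam t => lam (strSub a (v.renLam Nat.succ) t)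
  | a, v, app t w => app (strSub a v t) (strSub a v w)
  | a, v, mu b t =>
      if b = a + 1 then
        mu b (app (strSub (a + 1) (v.renMu Nat.succ) t) (v.renMu Nat.succ))
      else mu b (strSub (a + 1) (v.renMu Nat.succ) t)

/-- `μα (([β]t)[v/*α])`, where `μα[β]t` is `mu b t` (so `α` is not free in `v`). -/
def strMu (b : ℕ) (t v : Tm) : Tm :=
  if b = 0 then mu b (app (strSub 0 (v.renMu Nat.succ) t) (v.renMu Nat.succ))
  else mu b (strSub 0 (v.renMu Nat.succ) t)

/-- The λ-variable of index `x` occurs free in the term. -/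
def FreeVar : ℕ → Tm → Prop
  | x, var y => y = x
  | x, lam t => FreeVar (x + 1) t
  | x, app t w => FreeVar x t ∨ FreeVar x w
  | x, mu _ t => FreeVar x t

/-- The μ-variable of index `a` occurs free in the term. -/
def FreeMu : ℕ → Tm → Prop
  | _, var _ => False
  | a, lam t => FreeMu a t
  | a, app t w => FreeMu a t ∨ FreeMu a w
  | a, mu b t => b = a + 1 ∨ FreeMu (a + 1) t

/-- The term has no free λ-variable and no free μ-variable. -/
def Closed (t : Tm) : Prop :=
  (∀ x, ¬ FreeVar x t) ∧ ∀ a, ¬ FreeMu a t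

end Tm

open Tm

/-- `NamedIn a t v`: `[α]v` is a subterm of the term `t`, where `α` is the free μ-variable of
index `a` of `t`. The indices of the free variables of `v` are those of the place where `v`
stands. -/
inductive NamedIn : ℕ → Tm → Tm → Prop
  | here (a : ℕ) (t : Tm) : NamedIn a (mu (a + 1) t) t
  | mu {a : ℕ} {t v : Tm} (b : ℕ) : NamedIn (a + 1) t v → NamedIn a (mu b t) v
  | lam {a : ℕ} {t v : Tm} : NamedIn a t v → NamedIn a (lam t) v
  | appL {a : ℕ} {t v : Tm} (w : Tm) : NamedIn a t v → NamedIn a (app t w) v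
  | appR {a : ℕ} {w v : Tm} (t : Tm) : NamedIn a w v → NamedIn a (app t w) v

/-- For the term `μα[β]t`, written `mu b t`: `[α]v` is a subterm of the named term `[β]t`. -/
def NamedBy (b : ℕ) (t v : Tm) : Prop :=
  (b = 0 ∧ v = t) ∨ NamedIn 0 t v

/-- One step of reduction, in any context. -/
inductive Red : Tm → Tm → Prop
  /-- `(λx u)v → u[v/x]`. -/
  | c1 (t w : Tm) : Red (app (lam t) w) (t.inst w)
  /-- `(μα u)v → μα u[v/*α]`, `u` a named term. -/
  | c2 (b : ℕ) (t w : Tm) : Red (app (mu b t) w) (strMu b t w)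
  /-- `[α]μβ u → u[α/β]`, inside the `μγ` that stands before the named term. -/
  | s1 (a b : ℕ) (t : Tm) :
      Red (mu a (mu b t))
        (mu (Nat.casesOn b a (fun n => n)) (t.renMu (fun k => Nat.casesOn k a (fun n => n))))
  /-- `μα[α]u → u` if `α` is not free in `u`. -/
  | s2 (t : Tm) : ¬ FreeMu 0 t → Red (mu 0 t) (t.renMu Nat.pred)
  /-- `μα u → λx μα u[x/*α]` if the named term `u` has a subterm `[α]λy w`. -/
  | s3 (b : ℕ) (t w : Tm) : NamedBy b t (lam w) →
      Red (mu b t) (lam (strMu b (t.renLam Nat.succ) (var 0)))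
  | lam {t t' : Tm} : Red t t' → Red (lam t) (lam t')
  | appL {t t' : Tm} (w : Tm) : Red t t' → Red (app t w) (app t' w)
  | appR {w w' : Tm} (t : Tm) : Red w w' → Red (app t w) (app t w')
  | mu {t t' : Tm} (b : ℕ) : Red t t' → Red (mu b t) (mu b t')

/-- Normal terms: no reduction applies. -/
def Normal (t : Tm) : Prop := ∀ t', ¬ Red t t'

/-! ### Second-order formulas

The language `L` is any first-order language; individual terms are `L.Term ℕ`, the individual
variables being de Bruijn indices. A relation variable is given by its arity `k` and by an index
among the relation variables of arity `k`. -/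

inductive Fml (L : FirstOrder.Language.{u, v}) : Type (max u v)
  | bot : Fml L
  | rel {k : ℕ} (R : L.Relations k) (ts : Fin k → L.Term ℕ) : Fml L
  | pvar (k X : ℕ) (ts : Fin k → L.Term ℕ) : Fml L
  | imp (A B : Fml L) : Fml L
  /-- `∀x A`. -/
  | all1 (A : Fml L) : Fml L
  /-- `∀X A`, with `X` of arity `k`. -/
  | all2 (k : ℕ) (A : Fml L) : Fml L

namespace Fml

variable {L : FirstOrder.Language.{u, v}}

/-- A substitution of individual variables carried under `∀x`. -/
def up1 (σ : ℕ → L.Term ℕ) : ℕ → L.Term ℕ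
  | 0 => FirstOrder.Language.Term.var 0
  | n + 1 => (σ n).relabel Nat.succ

/-- Simultaneous substitution of terms for the individual variables. -/
def subst1 : (ℕ → L.Term ℕ) → Fml L → Fml L
  | _, bot => bot
  | σ, rel R ts => rel R (fun i => (ts i).subst σ)
  | σ, pvar k X ts => pvar k X (fun i => (ts i).subst σ)
  | σ, imp A B => imp (subst1 σ A) (subst1 σ B)
  | σ, all1 A => all1 (subst1 (up1 σ) A)
  | σ, all2 k A => all2 k (subst1 σ A)

/-- `A[a/x]`, where `x` is the individual variable of index `0`, which disappears. -/
def inst1 (A : Fml L) (a : L.Term ℕ) : Fml L :=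
  subst1 (fun x => match x with
    | 0 => a
    | n + 1 => FirstOrder.Language.Term.var n) A

/-- Make room for a new individual variable of index `0`. -/
def shift1 (A : Fml L) : Fml L :=
  subst1 (fun x => FirstOrder.Language.Term.var (x + 1)) A

/-- A renaming of relation variables carried under `∀X`, with `X` of arity `j`. -/
def upRen2 (j : ℕ) (ρ : ℕ → ℕ → ℕ) : ℕ → ℕ → ℕ :=
  fun k X => if k = j then upRen (ρ k) X else ρ k X

/-- Renaming of the relation variables. -/
def ren2 : (ℕ → ℕ → ℕ) → Fml L → Fml L
  | _, bot => bot
  | _, rel R ts => rel R ts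
  | ρ, pvar k X ts => pvar k (ρ k X) ts
  | ρ, imp A B => imp (ren2 ρ A) (ren2 ρ B)
  | ρ, all1 A => all1 (ren2 ρ A)
  | ρ, all2 j A => all2 j (ren2 (upRen2 j ρ) A)

/-- Make room for a new relation variable of arity `j` and index `0`. -/
def shift2 (j : ℕ) (A : Fml L) : Fml L :=
  ren2 (fun k X => if k = j then X + 1 else X) A

/-- The formula `X(x₁,…,x_k)`, where `x₁,…,x_k` are the individual variables of index
`0,…,k-1`. -/
def generic (k X : ℕ) : Fml L :=
  pvar k X (fun i => FirstOrder.Language.Term.var (i : ℕ))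

/-- `G[t₁/x₁,…,t_k/x_k]`, where `x₁,…,x_k` are the individual variables of index `0,…,k-1`, which
disappear. -/
def applyTo {k : ℕ} (G : Fml L) (ts : Fin k → L.Term ℕ) : Fml L :=
  subst1 (fun x => if h : x < k then ts ⟨x, h⟩ else FirstOrder.Language.Term.var (x - k)) G

/-- Make room for a new individual variable in a formula with the `k` parameters `0,…,k-1`. -/
def shift1Above (k : ℕ) (G : Fml L) : Fml L :=
  subst1 (fun x => FirstOrder.Language.Term.var (if x < k then x else x + 1)) G

/-- A substitution of relation variables carried under `∀X`, with `X` of arity `j`. -/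
def up2 (j : ℕ) (τ : ℕ → ℕ → Fml L) : ℕ → ℕ → Fml L :=
  fun k X => if k = j then
      match X with
      | 0 => generic k 0
      | Y + 1 => shift2 j (τ k Y)
    else shift2 j (τ k X)

/-- Simultaneous substitution of formulas for the relation variables: for every relation
variable `X` of arity `k`, `X(t₁,…,t_k)` becomes `(τ k X)[t₁/x₁,…,t_k/x_k]`. -/
def subst2 : (ℕ → ℕ → Fml L) → Fml L → Fml L
  | _, bot => bot
  | _, rel R ts => rel R ts
  | τ, pvar k X ts => (τ k X).applyTo ts
  | τ, imp A B => imp (subst2 τ A) (subst2 τ B)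
  | τ, all1 A => all1 (subst2 (fun k X => shift1Above k (τ k X)) A)
  | τ, all2 j A => all2 j (subst2 (up2 j τ) A)

/-- `A[G/X x₁…x_j]`, where `X` is the relation variable of arity `j` and index `0`, which
disappears, and `x₁,…,x_j` are the individual variables of index `0,…,j-1` of `G`. -/
def inst2 (j : ℕ) (A G : Fml L) : Fml L :=
  subst2 (fun k X => if k = j then
      match X with
      | 0 => G
      | Y + 1 => generic k Y
    else generic k X) A

end Fml

/-! ### Equations and typing -/

section Typing

variable {L : FirstOrder.Language.{u, v}}

/-- `⊢_E a = b`: the equation is a consequence of the equations in `E` (whose variables are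
understood as universally quantified), that is, derivable in equational logic. -/
inductive EqThy (E : Set (L.Term ℕ × L.Term ℕ)) : L.Term ℕ → L.Term ℕ → Prop
  | ax (a b : L.Term ℕ) (σ : ℕ → L.Term ℕ) : (a, b) ∈ E → EqThy E (a.subst σ) (b.subst σ)
  | refl (a : L.Term ℕ) : EqThy E a a
  | symm {a b : L.Term ℕ} : EqThy E a b → EqThy E b a
  | trans {a b c : L.Term ℕ} : EqThy E a b → EqThy E b c → EqThy E a c
  | congr {k : ℕ} (g : L.Functions k) (as bs : Fin k → L.Term ℕ) :
      (∀ i, EqThy E (as i) (bs i)) →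
      EqThy E (FirstOrder.Language.Term.func g as) (FirstOrder.Language.Term.func g bs)

/-- The term `0`. -/
def zeroT (zero : L.Functions 0) : L.Term ℕ :=
  FirstOrder.Language.Term.func zero Fin.elim0

/-- The term `s(a)`. -/
def succT (succ : L.Functions 1) (a : L.Term ℕ) : L.Term ℕ :=
  FirstOrder.Language.Term.func succ (fun _ => a)

/-- The term `sⁿ(0)`. -/
def numeral (zero : L.Functions 0) (succ : L.Functions 1) : ℕ → L.Term ℕ
  | 0 => zeroT zero
  | n + 1 => succT succ (numeral zero succ n)

/-- The set of equations `E` is adequate for the type of integers. -/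
def Adequate (zero : L.Functions 0) (succ : L.Functions 1)
    (E : Set (L.Term ℕ × L.Term ℕ)) : Prop :=
  (∀ a, ¬ EqThy E (succT succ a) (zeroT zero)) ∧
    ∀ a b, EqThy E (succT succ a) (succT succ b) → EqThy E a b

/-- `N[a] = ∀X {X(0), ∀y (X(y) → X(sy)) → X(a)}`. -/
def natFml (zero : L.Functions 0) (succ : L.Functions 1) (a : L.Term ℕ) : Fml L :=
  .all2 1
    (.imp (.pvar 1 0 (fun _ => zeroT zero))
      (.imp
        (.all1 (.imp (.pvar 1 0 (fun _ => FirstOrder.Language.Term.var 0))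
          (.pvar 1 0 (fun _ => succT succ (FirstOrder.Language.Term.var 0)))))
        (.pvar 1 0 (fun _ => a))))

/-- `Typed E Γ t A Δ` is `Γ ⊢ t : A, Δ`, with the equations of `E`. The `i`-th formula of `Γ` is
labelled by the λ-variable of index `i`, the `i`-th formula of `Δ` by the μ-variable of index
`i`. The shifts in `gen1` and `gen2` say that the generalized variable is not free in `Γ`, `Δ`. -/
inductive Typed (E : Set (L.Term ℕ × L.Term ℕ)) :
    List (Fml L) → Tm → Fml L → List (Fml L) → Prop
  | ax {Γ Δ : List (Fml L)} {i : ℕ} {A : Fml L} :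
      Γ[i]? = some A → Typed E Γ (var i) A Δ
  | abs {Γ Δ : List (Fml L)} {t : Tm} {A B : Fml L} :
      Typed E (A :: Γ) t B Δ → Typed E Γ (lam t) (.imp A B) Δ
  | app {Γ Δ : List (Fml L)} {t w : Tm} {A B : Fml L} :
      Typed E Γ t (.imp A B) Δ → Typed E Γ w A Δ → Typed E Γ (app t w) B Δ
  | gen1 {Γ Δ : List (Fml L)} {t : Tm} {A : Fml L} :
      Typed E (Γ.map Fml.shift1) t A (Δ.map Fml.shift1) → Typed E Γ t (.all1 A) Δ
  | inst1 {Γ Δ : List (Fml L)} {t : Tm} {A : Fml L} (a : L.Term ℕ) :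
      Typed E Γ t (.all1 A) Δ → Typed E Γ t (A.inst1 a) Δ
  | gen2 {Γ Δ : List (Fml L)} {t : Tm} {k : ℕ} {A : Fml L} :
      Typed E (Γ.map (Fml.shift2 k)) t A (Δ.map (Fml.shift2 k)) → Typed E Γ t (.all2 k A) Δ
  | inst2 {Γ Δ : List (Fml L)} {t : Tm} {k : ℕ} {A : Fml L} (G : Fml L) :
      Typed E Γ t (.all2 k A) Δ → Typed E Γ t (A.inst2 k G) Δ
  | eqn {Γ Δ : List (Fml L)} {t : Tm} (A : Fml L) {a b : L.Term ℕ} :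
      EqThy E a b → Typed E Γ t (A.inst1 a) Δ → Typed E Γ t (A.inst1 b) Δ
  /-- From `Γ ⊢ t : A, β : B, Δ` infer `Γ ⊢ μβ[α]t : B, Δ`, where `α : A` belongs to `β : B, Δ`
  (the case `α = β`, `A = B` included). -/
  | mu {Γ Δ : List (Fml L)} {t : Tm} {b : ℕ} {A B : Fml L} :
      (B :: Δ)[b]? = some A → Typed E Γ t A (B :: Δ) → Typed E Γ (mu b t) B Δ

/-- `θ` is a classical integer of value `n`. -/
def IsClassicalInteger (zero : L.Functions 0) (succ : L.Functions 1)
    (E : Set (L.Term ℕ × L.Term ℕ)) (n : ℕ) (θ : Tm) : Prop :=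
  θ.Closed ∧ Typed E [] θ (natFml zero succ (numeral zero succ n)) []

end Typing

/-! ### The terms of `N_{x,f}` and their values

No λ is met inside these terms, so the indices `x` and `f` stay the same everywhere. -/

/-- The set `N_{x,f}`. -/
inductive InN (x f : ℕ) : Tm → Prop
  | var : InN x f (var x)
  | muVar (b : ℕ) : InN x f (mu b (var x))
  | app {t : Tm} : InN x f t → InN x f (app (var f) t)
  | muApp (b : ℕ) {t : Tm} : InN x f t → InN x f (mu b (app (var f) t))

/-- `m ∈ val(t)`. -/
inductive HasVal (x f : ℕ) : Tm → ℕ → Prop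
  | var : HasVal x f (var x) 0
  | app {t : Tm} {m : ℕ} : HasVal x f t m → HasVal x f (app (var f) t) (m + 1)
  | mu {b : ℕ} {t v : Tm} {m : ℕ} : NamedBy b t v → HasVal x f v m → HasVal x f (mu b t) m

/-- The set `val(t)`: `val(x) = {0}`, `val((f)t) = {m+1 | m ∈ val(t)}`, and `val(μα[β]t)` is the
union of the `val(v)` over the subterms `[α]v` of `[β]t`. -/
def val (x f : ℕ) (t : Tm) : Set ℕ := {m | HasVal x f t m}

/-- `(f)ⁱt`. -/
def iterApp (f : ℕ) : ℕ → Tm → Tm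
  | 0, t => t
  | i + 1, t => app (var f) (iterApp f i t)

/-- `ReadOff x f u [i_{m+1}, i_m, …, i_1]`: `u = (f)^{i_{m+1}} μα_m u_m`, where `u_m` has the
subterm `[α_m](f)^{i_m} μα_{m-1} u_{m-1}`, …, where `u_2` has the subterm
`[α_2](f)^{i_2} μα_1 u_1`, where `u_1` has the subterm `[α_1](f)^{i_1} x`. For `m = 0` this is
`u = (f)^{i_1} x`. -/
inductive ReadOff (x f : ℕ) : Tm → List ℕ → Prop
  | last (i : ℕ) : ReadOff x f (iterApp f i (var x)) [i]
  | step (i : ℕ) {b : ℕ} {t v : Tm} {l : List ℕ} :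
      NamedBy b t v → ReadOff x f v l → ReadOff x f (iterApp f i (mu b t)) (i :: l)

end LamMu

namespace LamMu

open FirstOrder Language

-- The proof runs θ on an environment machine in the style of Krivine and reads its shape off the
-- successful run. Formulas denote sets of stacks, and a realizer is a closure that succeeds against
-- every stack of the set; quantifiers become unions of such sets. Every typed term realizes its
-- type in any model of E (`Typed.ok`). The individuals are the terms modulo E, where adequacy makes
-- n ↦ sⁿ(0) injective. Interpreting X(a) as the single stack whose bottom is a, the constants `x`
-- and `f` realize X(0) and ∀y(X(y) → X(sy)), so θ succeeds against x · f · sⁿ(0)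
-- (`IsClassicalInteger.ok`).
--
-- A successful run of a normal term leaves little choice. Redexes are excluded, so the head of an
-- application is a variable, and a variable runs only if its constant accepts the stack. This
-- forces θ = λxλf t (`Normal.exists_lam`). Inside t every μ-variable stores a bare bottom, so only
-- `x`, `f` applied once, and non-consecutive μ's can occur (`Normal.inN`).
--
-- A term of N_{x,f} is a chain ending in its single x. Going up from x, one path is determined,
-- each name leading to the μ that binds it; hence the read-off is unique (`InN.exists_path`), and
-- the values are exactly the sums of read-offs (`hasVal_iff`). Along the run each `f` removes one s
-- from the bottom, so the bottom where the path ends is s^k(0), k being the sum read off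
-- (`InN.path_sum`). At the top this bottom is sⁿ(0), and injectivity gives k = n.

/-- The sequence `a, e 0, e 1, …`. -/
def scons {α : Type*} (a : α) (e : ℕ → α) : ℕ → α
  | 0 => a
  | n + 1 => e n

/-! ### An environment machine for λμ-terms -/

mutual

/-- Closures: a term with values for its free variables, or one of the constants `x`, `f` and
`bad`, the last of which cannot be executed. -/
inductive Clo (D : Type u) : Type u
  | bad : Clo D
  | x : Clo D
  | f : Clo D
  | clo (t : Tm) (e : ℕ → Clo D) (m : ℕ → Stk D) : Clo D

/-- Stacks of closures, whose bottom is labelled by an element of `D`. -/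
inductive Stk (D : Type u) : Type u
  | atom (d : D) : Stk D
  | push (c : Clo D) (p : Stk D) : Stk D

end

section Machine

variable {D : Type*} (z : D) (s : D → D)

/-- The closure runs successfully against the stack. Here `x` expects the bottom labelled `z`, and
`f` with a bottom labelled `s d` runs its argument against the bottom labelled `d`. -/
inductive Ok : Clo D → Stk D → Prop
  | x : Ok .x (.atom z)
  | f {c : Clo D} {d : D} : Ok c (.atom d) → Ok .f (.push c (.atom (s d)))
  | var {i : ℕ} {e : ℕ → Clo D} {m : ℕ → Stk D} {p : Stk D} :
      Ok (e i) p → Ok (.clo (.var i) e m) p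
  | lam {t : Tm} {e : ℕ → Clo D} {m : ℕ → Stk D} {c : Clo D} {p : Stk D} :
      Ok (.clo t (scons c e) m) p → Ok (.clo (.lam t) e m) (.push c p)
  | app {t w : Tm} {e : ℕ → Clo D} {m : ℕ → Stk D} {p : Stk D} :
      Ok (.clo t e m) (.push (.clo w e m) p) → Ok (.clo (.app t w) e m) p
  | mu {b : ℕ} {t : Tm} {e : ℕ → Clo D} {m : ℕ → Stk D} {p : Stk D} :
      Ok (.clo t e (scons p m)) (scons p m b) → Ok (.clo (.mu b t) e m) p

variable {z s}

/-- The machine is syntax-directed: at most one rule of `Ok` concludes about each shape of closure,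
so success can be inverted step by step. -/
theorem not_ok_bad {p : Stk D} : ¬ Ok z s .bad p := by
  intro h; cases h

theorem ok_x_iff {p : Stk D} : Ok z s .x p ↔ p = .atom z :=
  ⟨fun h => by cases h; rfl, fun h => h ▸ .x⟩

theorem ok_f_iff {p : Stk D} :
    Ok z s .f p ↔ ∃ c d, p = .push c (.atom (s d)) ∧ Ok z s c (.atom d) :=
  ⟨fun h => by cases h with | f h => exact ⟨_, _, rfl, h⟩, by rintro ⟨c, d, rfl, h⟩; exact .f h⟩

theorem ok_var_iff {i : ℕ} {e : ℕ → Clo D} {m : ℕ → Stk D} {p : Stk D} :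
    Ok z s (.clo (.var i) e m) p ↔ Ok z s (e i) p :=
  ⟨fun h => by cases h with | var h => exact h, .var⟩

theorem ok_lam_iff {t : Tm} {e : ℕ → Clo D} {m : ℕ → Stk D} {p : Stk D} :
    Ok z s (.clo (.lam t) e m) p ↔
      ∃ c q, p = .push c q ∧ Ok z s (.clo t (scons c e) m) q :=
  ⟨fun h => by cases h with | lam h => exact ⟨_, _, rfl, h⟩, by rintro ⟨c, d, rfl, h⟩; exact .lam h⟩

theorem ok_app_iff {t w : Tm} {e : ℕ → Clo D} {m : ℕ → Stk D} {p : Stk D} :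
    Ok z s (.clo (.app t w) e m) p ↔ Ok z s (.clo t e m) (.push (.clo w e m) p) :=
  ⟨fun h => by cases h with | app h => exact h, .app⟩

theorem ok_mu_iff {b : ℕ} {t : Tm} {e : ℕ → Clo D} {m : ℕ → Stk D} {p : Stk D} :
    Ok z s (.clo (.mu b t) e m) p ↔ Ok z s (.clo t e (scons p m)) (scons p m b) :=
  ⟨fun h => by cases h with | mu h => exact h, .mu⟩

end Machine

/-! ### Realizability -/

section Interp

variable {L : FirstOrder.Language.{u, v}} {D : Type*}

/-- A valuation of the relation variables carried under `∀X`, with `X` of arity `j`. -/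
def consRel (j : ℕ) (P : (Fin j → D) → Set (Stk D)) (V : (k : ℕ) → ℕ → (Fin k → D) → Set (Stk D)) :
    (k : ℕ) → ℕ → (Fin k → D) → Set (Stk D) :=
  fun k X => if h : k = j then
      match X with
      | 0 => h ▸ P
      | Y + 1 => V k Y
    else V k X

/-- The sequence `ds 0, …, ds (k - 1), v 0, v 1, …`. -/
def prepend {k : ℕ} (ds : Fin k → D) (v : ℕ → D) : ℕ → D :=
  fun x => if h : x < k then ds ⟨x, h⟩ else v (x - k)

variable [L.Structure D] (z : D) (s : D → D)

/-- The stacks against which the realizers of a formula have to run successfully. -/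
def interp : (ℕ → D) → ((k : ℕ) → ℕ → (Fin k → D) → Set (Stk D)) → Fml L → Set (Stk D)
  | _, _, .bot => ∅
  | _, _, .rel _ _ => ∅
  | v, V, .pvar k X ts => V k X (fun i => (ts i).realize v)
  | v, V, .imp A B => {p | ∃ c q, p = .push c q ∧ (∀ r ∈ interp v V A, Ok z s c r) ∧
      q ∈ interp v V B}
  | v, V, .all1 A => {p | ∃ d, p ∈ interp (scons d v) V A}
  | v, V, .all2 k A => {p | ∃ P, p ∈ interp v (consRel k P V) A}

variable {z s}

-- Substitution lemmas for the interpretation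

theorem interp_subst1 (A : Fml L) (σ : ℕ → L.Term ℕ) (v : ℕ → D)
    (V : (k : ℕ) → ℕ → (Fin k → D) → Set (Stk D)) :
    interp z s v V (A.subst1 σ) = interp z s (fun x => (σ x).realize v) V A := by
  induction A generalizing σ v V with
  | bot => rfl
  | rel R ts => rfl
  | pvar k X ts => simp [Fml.subst1, interp, Term.realize_subst]
  | imp A B ihA ihB => simp [Fml.subst1, interp, ihA, ihB]
  | all1 A ih =>
    simp only [Fml.subst1, interp, ih]
    ext p
    refine exists_congr fun d => ?_
    have : (fun x => (Fml.up1 σ x).realize (scons d v)) =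
        scons d (fun x => (σ x).realize v) := by
      funext x
      cases x with
      | zero => rfl
      | succ n => simp only [Fml.up1, Term.realize_relabel]; rfl
    rw [this]
  | all2 k A ih => simp [Fml.subst1, interp, ih]

theorem interp_ren2 (A : Fml L) (ρ : ℕ → ℕ → ℕ) (v : ℕ → D)
    (V : (k : ℕ) → ℕ → (Fin k → D) → Set (Stk D)) :
    interp z s v V (A.ren2 ρ) = interp z s v (fun k X => V k (ρ k X)) A := by
  induction A generalizing ρ v V with
  | bot => rfl
  | rel R ts => rfl
  | pvar k X ts => rfl
  | imp A B ihA ihB => simp [Fml.ren2, interp, ihA, ihB]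
  | all1 A ih => simp [Fml.ren2, interp, ih]
  | all2 j A ih =>
    simp only [Fml.ren2, interp, ih]
    ext p
    refine exists_congr fun P => ?_
    have : (fun k X => consRel j P V k (Fml.upRen2 j ρ k X)) =
        consRel j P (fun k X => V k (ρ k X)) := by
      funext k X
      by_cases h : k = j
      · subst h; cases X <;> simp [consRel, Fml.upRen2, upRen]
      · simp [consRel, Fml.upRen2, h]
    rw [this]

theorem interp_shift1 (A : Fml L) (d : D) (v : ℕ → D)
    (V : (k : ℕ) → ℕ → (Fin k → D) → Set (Stk D)) :
    interp z s (scons d v) V A.shift1 = interp z s v V A := by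
  rw [Fml.shift1, interp_subst1]; rfl

theorem interp_inst1 (A : Fml L) (a : L.Term ℕ) (v : ℕ → D)
    (V : (k : ℕ) → ℕ → (Fin k → D) → Set (Stk D)) :
    interp z s v V (A.inst1 a) = interp z s (scons (a.realize v) v) V A := by
  rw [Fml.inst1, interp_subst1]
  congr 1
  funext x
  cases x <;> rfl

theorem interp_shift2 (j : ℕ) (A : Fml L) (P : (Fin j → D) → Set (Stk D)) (v : ℕ → D)
    (V : (k : ℕ) → ℕ → (Fin k → D) → Set (Stk D)) :
    interp z s v (consRel j P V) (A.shift2 j) = interp z s v V A := by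
  rw [Fml.shift2, interp_ren2]
  congr 1
  funext k X
  by_cases h : k = j
  · subst h; simp [consRel]
  · simp [consRel, h]

theorem interp_applyTo {k : ℕ} (G : Fml L) (ts : Fin k → L.Term ℕ) (v : ℕ → D)
    (V : (k : ℕ) → ℕ → (Fin k → D) → Set (Stk D)) :
    interp z s v V (G.applyTo ts) = interp z s (prepend (fun i => (ts i).realize v) v) V G := by
  rw [Fml.applyTo, interp_subst1]
  congr 1
  funext x
  by_cases h : x < k <;> simp [prepend, h]

theorem interp_shift1Above {k : ℕ} (G : Fml L) (ds : Fin k → D) (d : D) (v : ℕ → D)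
    (V : (k : ℕ) → ℕ → (Fin k → D) → Set (Stk D)) :
    interp z s (prepend ds (scons d v)) V (G.shift1Above k) = interp z s (prepend ds v) V G := by
  rw [Fml.shift1Above, interp_subst1]
  congr 1
  funext x
  by_cases h : x < k
  · simp [prepend, h]
  · have h1 : ¬ x + 1 < k := by omega
    have h2 : x + 1 - k = (x - k) + 1 := by omega
    simp [prepend, h, h1, h2, scons]

theorem interp_generic (k X : ℕ) (ds : Fin k → D) (v : ℕ → D)
    (V : (k : ℕ) → ℕ → (Fin k → D) → Set (Stk D)) :
    interp z s (prepend ds v) V (Fml.generic k X : Fml L) = V k X ds := by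
  simp [Fml.generic, interp, prepend]

theorem interp_subst2 (A : Fml L) (τ : ℕ → ℕ → Fml L) (v : ℕ → D)
    (V : (k : ℕ) → ℕ → (Fin k → D) → Set (Stk D)) :
    interp z s v V (A.subst2 τ) =
      interp z s v (fun k X ds => interp z s (prepend ds v) V (τ k X)) A := by
  induction A generalizing τ v V with
  | bot => rfl
  | rel R ts => rfl
  | pvar k X ts => simp [Fml.subst2, interp, interp_applyTo]
  | imp A B ihA ihB => simp [Fml.subst2, interp, ihA, ihB]
  | all1 A ih => simp [Fml.subst2, interp, ih, interp_shift1Above]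
  | all2 j A ih =>
    simp only [Fml.subst2, interp, ih]
    ext p
    refine exists_congr fun P => ?_
    have : (fun k X ds => interp z s (prepend ds v) (consRel j P V) (Fml.up2 j τ k X)) =
        consRel j P (fun k X ds => interp z s (prepend ds v) V (τ k X)) := by
      funext k X ds
      by_cases h : k = j
      · subst h
        cases X <;> simp [consRel, Fml.up2, interp_generic, interp_shift2]
      · simp [consRel, Fml.up2, h, interp_shift2]
    rw [this]

/-- Soundness of second-order instantiation: ∀X ranges over all set-valued predicates, among them
the one defined by G with the current valuation as parameters. -/
theorem interp_inst2 (j : ℕ) (A G : Fml L) (v : ℕ → D)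
    (V : (k : ℕ) → ℕ → (Fin k → D) → Set (Stk D)) :
    interp z s v V (A.inst2 j G) =
      interp z s v (consRel j (fun ds => interp z s (prepend ds v) V G) V) A := by
  rw [Fml.inst2, interp_subst2]
  congr 1
  funext k X ds
  by_cases h : k = j
  · subst h; cases X <;> simp [consRel, interp_generic]
  · simp [consRel, h, interp_generic]

/-- A typed term realizes its type, in any model of the equations. -/
theorem Typed.ok {E : Set (L.Term ℕ × L.Term ℕ)}
    (hE : ∀ a b, EqThy E a b → ∀ v : ℕ → D, a.realize v = b.realize v)
    {Γ Δ : List (Fml L)} {t : Tm} {A : Fml L} (h : Typed E Γ t A Δ) (v : ℕ → D)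
    (V : (k : ℕ) → ℕ → (Fin k → D) → Set (Stk D)) (e : ℕ → Clo D) (m : ℕ → Stk D)
    (he : ∀ i B, Γ[i]? = some B → ∀ q ∈ interp z s v V B, Ok z s (e i) q)
    (hm : ∀ i B, Δ[i]? = some B → m i ∈ interp z s v V B) :
    ∀ p ∈ interp z s v V A, Ok z s (.clo t e m) p := by
  induction h generalizing v V e m with
  | ax hi => exact fun p hp => .var (he _ _ hi p hp)
  | abs _ ih =>
    rintro p ⟨c, q, rfl, hc, hq⟩
    refine .lam (ih v V _ m ?_ hm q hq)
    rintro (_ | i) B hB r hr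
    · obtain rfl : _ = B := by simpa using hB
      exact hc r hr
    · exact he i B (by simpa using hB) r hr
  | app _ _ iht ihw =>
    exact fun p hp => .app (iht v V e m he hm _ ⟨_, p, rfl, ihw v V e m he hm, hp⟩)
  | gen1 _ ih =>
    rintro p ⟨d, hp⟩
    refine ih (scons d v) V e m ?_ ?_ p hp
    · intro i B hB
      rw [List.getElem?_map, Option.map_eq_some_iff] at hB
      obtain ⟨B, hB, rfl⟩ := hB
      rw [interp_shift1]
      exact he i B hB
    · intro i B hB
      rw [List.getElem?_map, Option.map_eq_some_iff] at hB
      obtain ⟨B, hB, rfl⟩ := hB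
      rw [interp_shift1]
      exact hm i B hB
  | inst1 a _ ih =>
    intro p hp
    rw [interp_inst1] at hp
    exact ih v V e m he hm p ⟨_, hp⟩
  | gen2 _ ih =>
    rintro p ⟨P, hp⟩
    refine ih v (consRel _ P V) e m ?_ ?_ p hp
    · intro i B hB
      rw [List.getElem?_map, Option.map_eq_some_iff] at hB
      obtain ⟨B, hB, rfl⟩ := hB
      rw [interp_shift2]
      exact he i B hB
    · intro i B hB
      rw [List.getElem?_map, Option.map_eq_some_iff] at hB
      obtain ⟨B, hB, rfl⟩ := hB
      rw [interp_shift2]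
      exact hm i B hB
  | inst2 G _ ih =>
    intro p hp
    rw [interp_inst2] at hp
    exact ih v V e m he hm p ⟨_, hp⟩
  -- The only case that needs the individuals to form a model of E.
  | eqn A hab _ ih =>
    intro p hp
    rw [interp_inst1, ← hE _ _ hab, ← interp_inst1] at hp
    exact ih v V e m he hm p hp
  -- The current stack is stored for β, and execution goes on against the stack stored for the name,
  -- which may be the same one.
  | @mu Γ Δ t b A B hb _ ih =>
    intro p hp
    have hm' : ∀ (i : ℕ) (C : Fml L), (B :: Δ)[i]? = some C → scons p m i ∈ interp z s v V C := by
      rintro (_ | i) C hC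
      · obtain rfl : _ = C := by simpa using hC
        exact hp
      · exact hm i C (by simpa using hC)
    exact .mu (ih v V e _ he hm' _ (hm' _ _ hb))

end Interp

/-! ### The term model -/

section TermModel

variable {L : FirstOrder.Language.{u, v}} (E : Set (L.Term ℕ × L.Term ℕ))

/-- Provable equality of individual terms. -/
def eqSetoid : Setoid (L.Term ℕ) where
  r := EqThy E
  iseqv := ⟨.refl, .symm, .trans⟩

/-- Individual terms modulo provable equality. -/
abbrev TermModel : Type u := Quotient (eqSetoid E)

/-- Relation symbols may be interpreted arbitrarily, since `interp` sends every `rel` formula to ∅.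
-/
noncomputable instance : L.Structure (TermModel E) where
  funMap g xs := Quotient.mk (eqSetoid E) (.func g fun i => (xs i).out)
  RelMap _ _ := False

variable {E}

theorem TermModel.funMap_mk {k : ℕ} (g : L.Functions k) (as : Fin k → L.Term ℕ) :
    Structure.funMap g (fun i => (Quotient.mk (eqSetoid E) (as i) : TermModel E)) =
      Quotient.mk (eqSetoid E) (.func g as) :=
  Quotient.sound (s := eqSetoid E)
    (EqThy.congr g _ _ fun i => Quotient.mk_out (s := eqSetoid E) (as i))

theorem TermModel.realize_eq (a : L.Term ℕ) (v : ℕ → TermModel E) :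
    a.realize v = Quotient.mk (eqSetoid E) (a.subst fun x => (v x).out) := by
  induction a with
  | var x => exact (Quotient.out_eq _).symm
  | func g as ih =>
    simp only [Term.realize_func, ih, Term.subst]
    exact funMap_mk g _

/-- Evaluation in the term model is substitution of representatives, and the axioms of `EqThy` are
closed under substitution. -/
theorem EqThy.realize_eq {a b : L.Term ℕ} (h : EqThy E a b) (v : ℕ → TermModel E) :
    a.realize v = b.realize v := by
  induction h generalizing v with
  | ax a b σ hab =>
    rw [Term.realize_subst, Term.realize_subst, TermModel.realize_eq, TermModel.realize_eq]
    exact Quotient.sound (s := eqSetoid E) (.ax a b _ hab)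
  | refl a => rfl
  | symm _ ih => exact (ih v).symm
  | trans _ _ ih₁ ih₂ => exact (ih₁ v).trans (ih₂ v)
  | congr g as bs _ ih => simp [Term.realize_func, ih]

/-- The interpretation of a unary function symbol in the term model. -/
noncomputable def TermModel.succ (succ : L.Functions 1) (d : TermModel E) : TermModel E :=
  Structure.funMap succ fun _ => d

theorem TermModel.realize_numeral (zero : L.Functions 0) (succ : L.Functions 1) (n : ℕ)
    (v : ℕ → TermModel E) :
    (numeral zero succ n).realize v = (TermModel.succ succ)^[n] ((zeroT zero).realize v) := by
  induction n with
  | zero => rfl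
  | succ n ih =>
    rw [Function.iterate_succ_apply', ← ih]
    rfl

theorem TermModel.succ_mk (succ : L.Functions 1) (a : L.Term ℕ) :
    TermModel.succ succ (Quotient.mk (eqSetoid E) a : TermModel E) =
      Quotient.mk (eqSetoid E) (succT succ a) :=
  funMap_mk succ _

theorem TermModel.realize_zero (zero : L.Functions 0) (v : ℕ → TermModel E) :
    (zeroT zero).realize v = Quotient.mk (eqSetoid E) (zeroT zero) := by
  rw [realize_eq]
  congr 1
  simp only [zeroT, Term.subst]
  congr 1
  exact Subsingleton.elim _ _

/-- On the quotient, the two clauses of adequacy become Peano's axioms: s is injective and 0 is not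
a successor. -/
theorem TermModel.iterate_succ_injective {zero : L.Functions 0} {succ : L.Functions 1}
    (hE : Adequate zero succ E) :
    Function.Injective fun n =>
      (TermModel.succ succ)^[n] (Quotient.mk (eqSetoid E) (zeroT zero) : TermModel E) := by
  have hinj : Function.Injective (TermModel.succ succ : TermModel E → TermModel E) := by
    intro c d h
    induction c, d using Quotient.inductionOn₂ with
    | _ a b =>
      rw [succ_mk, succ_mk] at h
      exact Quotient.sound (s := eqSetoid E) (hE.2 a b (Quotient.exact (s := eqSetoid E) h))
  have hne : ∀ d : TermModel E,
      TermModel.succ succ d ≠ Quotient.mk (eqSetoid E) (zeroT zero) := by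
    intro d h
    induction d using Quotient.inductionOn with
    | _ a =>
      rw [succ_mk] at h
      exact hE.1 a (Quotient.exact (s := eqSetoid E) h)
  intro m
  induction m with
  | zero =>
    rintro (_ | n) h
    · rfl
    · simp only [Function.iterate_succ_apply', Function.iterate_zero, id] at h
      exact (hne _ h.symm).elim
  | succ m ih =>
    rintro (_ | n) h
    · simp only [Function.iterate_succ_apply', Function.iterate_zero, id] at h
      exact (hne _ h).elim
    · simp only [Function.iterate_succ_apply'] at h
      rw [ih (hinj h)]

theorem IsClassicalInteger.ok {zero : L.Functions 0} {succ : L.Functions 1} {n : ℕ} {θ : Tm}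
    (hθ : IsClassicalInteger zero succ E n θ) (m : ℕ → Stk (TermModel E)) :
    Ok (Quotient.mk (eqSetoid E) (zeroT zero)) (TermModel.succ succ) (.clo θ (fun _ => .bad) m)
      (.push .x (.push .f (.atom ((TermModel.succ succ)^[n]
        (Quotient.mk (eqSetoid E) (zeroT zero)))))) := by
  let v : ℕ → TermModel E := fun _ => Quotient.mk (eqSetoid E) (zeroT zero)
  refine hθ.2.ok (fun a b h v => h.realize_eq v) v (fun _ _ _ => ∅) _ m (by simp) (by simp) _ ?_
  -- X(a) is interpreted as the singleton consisting of the bottom labelled a; the remaining goals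
  -- are that `x` and `f` realize their types and that the final bottom is the right one.
  refine ⟨fun ds => {.atom (ds 0)}, _, _, rfl, ?_, _, _, rfl, ?_, ?_⟩
  · rintro q hq
    rw [ok_x_iff]
    simpa [interp, consRel, TermModel.realize_zero] using hq
  · rintro q ⟨d, c, r, rfl, hc, hr⟩
    rw [ok_f_iff]
    refine ⟨c, d, ?_, hc _ ?_⟩
    · have : r = .atom ((succT succ (.var 0)).realize (scons d v)) := by
        simpa [interp, consRel] using hr
      rw [this]
      rfl
    · simp [interp, consRel, scons]
  · simp [interp, consRel, TermModel.realize_numeral, TermModel.realize_zero]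

end TermModel

/-! ### Normal terms that run successfully -/

section Normal

theorem Normal.of_lam {t : Tm} (h : Normal (.lam t)) : Normal t :=
  fun _ h' => h _ (.lam h')

theorem Normal.of_appL {t w : Tm} (h : Normal (.app t w)) : Normal t :=
  fun _ h' => h _ (.appL w h')

theorem Normal.of_appR {t w : Tm} (h : Normal (.app t w)) : Normal w :=
  fun _ h' => h _ (.appR t h')

theorem Normal.of_mu {b : ℕ} {t : Tm} (h : Normal (.mu b t)) : Normal t :=
  fun _ h' => h _ (.mu b h')

variable {D : Type*} {z : D} {s : D → D}

/-- If no variable runs successfully against a stack obtained from `p` by adding closures, then the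
function part of a normal application does not either. -/
theorem Normal.not_ok_push {e : ℕ → Clo D} {m : ℕ → Stk D} (Q : Stk D → Prop)
    (hQ : ∀ c p, Q p → Q (.push c p)) (he : ∀ i p, Q p → ¬ Ok z s (e i) p) {t w : Tm}
    (h : Normal (.app t w)) {p : Stk D} (hp : Q p) : ¬ Ok z s (.clo t e m) p := by
  induction t generalizing w p with
  | var i => rw [ok_var_iff]; exact he i p hp
  | lam t => exact (h _ (.c1 t w)).elim
  | mu b t => exact (h _ (.c2 b t w)).elim
  | app t w ih =>
    rw [ok_app_iff]
    exact ih h.of_appL (hQ _ _ hp)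

/-- A normal term without free `μ`-variables is an abstraction if no variable runs successfully
against its stack. -/
theorem Normal.exists_lam {e : ℕ → Clo D} {m : ℕ → Stk D} (Q : Stk D → Prop)
    (hQ : ∀ c p, Q p → Q (.push c p)) (he : ∀ i p, Q p → ¬ Ok z s (e i) p) {t : Tm}
    (h : Normal t) (hc : ∀ a, ¬ Tm.FreeMu a t) {p : Stk D} (hp : Q p)
    (hok : Ok z s (.clo t e m) p) : ∃ w, t = .lam w := by
  cases t with
  | var i => exact (he i p hp (ok_var_iff.1 hok)).elim
  | lam t => exact ⟨t, rfl⟩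
  | app t w => exact (h.not_ok_push Q hQ he (hQ _ _ hp) (ok_app_iff.1 hok)).elim
  | mu b t =>
    obtain rfl : b = 0 := by
      cases b with
      | zero => rfl
      | succ b => exact (hc b (Or.inl rfl)).elim
    replace hok : Ok z s (.clo t e (scons p m)) p := ok_mu_iff.1 hok
    -- The only name available is the variable just bound, so the body meets p again; an abstraction
    -- here would be an `s3` redex and a second μ an `s1` redex.
    cases t with
    | var i => exact (he i p hp (ok_var_iff.1 hok)).elim
    | lam t => exact (h _ (.s3 0 _ t (Or.inl ⟨rfl, rfl⟩))).elim
    | app t w => exact (h.of_mu.not_ok_push Q hQ he (hQ _ _ hp) (ok_app_iff.1 hok)).elim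
    | mu b t => exact (h _ (.s1 0 b t)).elim

/-- The environment in which `0` stands for `f`, `1` for `x`, and nothing else can be executed. -/
def envXF (D : Type*) : ℕ → Clo D := scons .f (scons .x fun _ => .bad)

/-- `x` accepts no argument and `f` exactly one. -/
theorem not_ok_envXF (i : ℕ) (c c' : Clo D) (p : Stk D) :
    ¬ Ok z s (envXF D i) (.push c (.push c' p)) := by
  rcases i with _ | _ | i
  · change ¬ Ok z s .f _
    simp [ok_f_iff]
  · change ¬ Ok z s .x _
    simp [ok_x_iff]
  · exact not_ok_bad

theorem scons_atom (d : D) (δ : ℕ → D) :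
    scons (Stk.atom d) (fun i => Stk.atom (δ i)) = fun i => .atom (scons d δ i) := by
  funext i
  cases i <;> rfl

/-- The function part of an application run against a bottom is the variable `f`. -/
theorem Normal.app_ok {t w : Tm} (h : Normal (.app t w)) {m : ℕ → Stk D} {d : D}
    (hok : Ok z s (.clo (.app t w) (envXF D) m) (.atom d)) :
    t = .var 0 ∧ ∃ d', d = s d' ∧ Ok z s (.clo w (envXF D) m) (.atom d') := by
  rw [ok_app_iff] at hok
  cases t with
  | var i =>
    rw [ok_var_iff] at hok
    rcases i with _ | _ | i
    · obtain ⟨c, d', hp, hc⟩ := ok_f_iff.1 hok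
      cases hp
      exact ⟨rfl, d', rfl, hc⟩
    · cases ok_x_iff.1 hok
    · exact (not_ok_bad hok).elim
  | lam t => exact (h _ (.c1 t w)).elim
  | mu b t => exact (h _ (.c2 b t w)).elim
  | app t u =>
    rw [ok_app_iff] at hok
    refine (h.of_appL.not_ok_push (fun p => ∃ c c' q, p = .push c (.push c' q)) ?_ ?_
      ⟨_, _, _, rfl⟩ hok).elim
    · rintro c _ ⟨c₁, c₂, q, rfl⟩
      exact ⟨_, _, _, rfl⟩
    · rintro i _ ⟨c₁, c₂, q, rfl⟩
      exact not_ok_envXF i c₁ c₂ q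

/-- Stacks stored for μ-variables are all bare bottoms, so the invariant survives every μ and every
argument of `f`. A bare bottom rules out abstractions and an unapplied `f`. -/
theorem Normal.inN {t : Tm} (h : Normal t) {δ : ℕ → D} {d : D}
    (hok : Ok z s (.clo t (envXF D) fun i => .atom (δ i)) (.atom d)) : InN 1 0 t := by
  induction t generalizing δ d with
  | var i =>
    rw [ok_var_iff] at hok
    rcases i with _ | _ | i
    · obtain ⟨c, d', hp, hc⟩ := ok_f_iff.1 hok
      cases hp
    · exact .var
    · exact (not_ok_bad hok).elim
  | lam t =>
    obtain ⟨c, q, hp, -⟩ := ok_lam_iff.1 hok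
    cases hp
  | app t w _ ih =>
    obtain ⟨rfl, d', -, hw⟩ := h.app_ok hok
    exact .app (ih h.of_appR hw)
  | mu b t ih =>
    rw [ok_mu_iff, scons_atom] at hok
    cases ih h.of_mu hok with
    | var => exact .muVar b
    | app ht => exact .muApp b ht
    -- Two consecutive μ's form an `s1` redex; this is why N_{x,f} has separate clauses for μ.
    | muVar b' => exact (h _ (.s1 b b' _)).elim
    | muApp b' => exact (h _ (.s1 b b' _)).elim

end Normal

/-! ### Values and read-offs -/

section ReadOff

variable {x f : ℕ}

/-- Merges the two μ clauses of `InN` into one step, so that later arguments need not look below the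
μ. -/
theorem InN.induction {P : (t : Tm) → InN x f t → Prop} (var : P (.var x) .var)
    (app : ∀ t (h : InN x f t), P t h → P (.app (.var f) t) (.app h))
    (mu : ∀ b t (h : InN x f t) (h' : InN x f (.mu b t)), P t h → P (.mu b t) h')
    {t : Tm} (h : InN x f t) : P t h := by
  induction h with
  | var => exact var
  | muVar b => exact mu b _ .var _ var
  | app ht ih => exact app _ ht ih
  | muApp b ht ih => exact mu b _ (.app ht) _ (app _ ht ih)

theorem readOff_var_iff {l : List ℕ} : ReadOff x f (.var x) l ↔ l = [0] := by
  constructor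
  · intro h
    generalize hu : Tm.var x = u at h
    cases h with
    | last i => cases i with
      | zero => rfl
      | succ i => cases hu
    | step i _ _ => cases i <;> cases hu
  · rintro rfl
    exact .last 0

theorem readOff_app_iff {t : Tm} {l : List ℕ} :
    ReadOff x f (.app (.var f) t) l ↔ ∃ i l', l = (i + 1) :: l' ∧ ReadOff x f t (i :: l') := by
  constructor
  · intro h
    generalize hu : Tm.app (.var f) t = u at h
    cases h with
    | last i => cases i with
      | zero => cases hu
      | succ i =>
        cases hu
        exact ⟨i, [], rfl, .last i⟩
    | step i hv hl => cases i with
      | zero => cases hu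
      | succ i =>
        cases hu
        exact ⟨i, _, rfl, .step i hv hl⟩
  · rintro ⟨i, l', rfl, h⟩
    generalize hl : i :: l' = l at h
    cases h with
    | last i => cases hl; exact .last (i + 1)
    | step i hv h => cases hl; exact .step (i + 1) hv h

theorem readOff_mu_iff {b : ℕ} {t : Tm} {l : List ℕ} :
    ReadOff x f (.mu b t) l ↔ ∃ l', l = 0 :: l' ∧ ∃ v, NamedBy b t v ∧ ReadOff x f v l' := by
  constructor
  · intro h
    generalize hu : Tm.mu b t = u at h
    cases h with
    | last i => cases i <;> cases hu
    | step i hv hl => cases i with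
      | zero => cases hu; exact ⟨_, rfl, _, hv, hl⟩
      | succ i => cases hu
  · rintro ⟨l', rfl, v, hv, hl⟩
    exact .step 0 hv hl

theorem ReadOff.ne_nil {t : Tm} {l : List ℕ} (h : ReadOff x f t l) : l ≠ [] := by
  cases h <;> simp

/-- Both sides make the same choice of a named subterm at each μ met; the value counts the `f`'s
passed, and the read-off groups them between μ's. -/
theorem hasVal_iff {t : Tm} {n : ℕ} : HasVal x f t n ↔ ∃ l, ReadOff x f t l ∧ l.sum = n := by
  constructor
  · intro h
    induction h with
    | var => exact ⟨[0], .last 0, rfl⟩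
    | app _ ih =>
      obtain ⟨_ | ⟨i, l⟩, hl, rfl⟩ := ih
      · exact (hl.ne_nil rfl).elim
      · exact ⟨(i + 1) :: l, readOff_app_iff.2 ⟨i, l, rfl, hl⟩, by simp; omega⟩
    | mu hv _ ih =>
      obtain ⟨l, hl, rfl⟩ := ih
      exact ⟨0 :: l, .step 0 hv hl, by simp⟩
  · have iter : ∀ {t : Tm} {n : ℕ} (i : ℕ), HasVal x f t n →
        HasVal x f (iterApp f i t) (i + n) := by
      intro t n i h
      induction i with
      | zero => rw [Nat.zero_add]; exact h
      | succ i ih => rw [Nat.add_right_comm]; exact .app ih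
    rintro ⟨l, hl, rfl⟩
    induction hl with
    | last i => simpa using iter i (.var (x := x))
    | step i hv _ ih => rw [List.sum_cons]; exact iter i (.mu hv ih)

theorem namedIn_var_iff {a y : ℕ} {v : Tm} : NamedIn a (.var y) v ↔ False :=
  ⟨(nomatch ·), False.elim⟩

theorem namedIn_app_iff {a : ℕ} {t w v : Tm} :
    NamedIn a (.app t w) v ↔ NamedIn a t v ∨ NamedIn a w v :=
  ⟨fun h => by cases h with | appL _ h => exact .inl h | appR _ h => exact .inr h,
    fun h => h.elim (.appL w) (.appR t)⟩

theorem namedIn_mu_iff {a b : ℕ} {t v : Tm} :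
    NamedIn a (.mu b t) v ↔ (b = a + 1 ∧ v = t) ∨ NamedIn (a + 1) t v := by
  constructor
  · intro h
    cases h with
    | here => exact .inl ⟨rfl, rfl⟩
    | mu _ h => exact .inr h
  · rintro (⟨rfl, rfl⟩ | h)
    · exact .here _ _
    · exact .mu _ h

theorem NamedIn.freeMu {a : ℕ} {t v : Tm} (h : NamedIn a t v) : Tm.FreeMu a t := by
  induction h with
  | here a t => exact .inl rfl
  | mu b _ ih => exact .inr ih
  | lam _ ih => exact ih
  | appL w _ ih => exact .inl ih
  | appR t _ ih => exact .inr ih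

/-- `Path x f t o l`: going up from `x`, the list `l` is read off either up to the whole term `t`
(for `o = none`) or up to a subterm `[α]v` with `α` of index `a` free in `t` (for `o = some a`). -/
def Path (x f : ℕ) (t : Tm) : Option ℕ → List ℕ → Prop
  | none, l => ReadOff x f t l
  | some a, l => ∃ v, NamedIn a t v ∧ ReadOff x f v l

theorem path_none_mu_iff {b : ℕ} {t : Tm} {l : List ℕ} :
    Path x f (.mu b t) none l ↔
      ∃ l', l = 0 :: l' ∧ ((b = 0 ∧ Path x f t none l') ∨ Path x f t (some 0) l') := by
  refine readOff_mu_iff.trans (exists_congr fun l' => and_congr_right fun _ => ?_)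
  constructor
  · rintro ⟨v, ⟨hb, rfl⟩ | hv, hl⟩
    · exact .inl ⟨hb, hl⟩
    · exact .inr ⟨v, hv, hl⟩
  · rintro (⟨hb, hl⟩ | ⟨v, hv, hl⟩)
    · exact ⟨t, .inl ⟨hb, rfl⟩, hl⟩
    · exact ⟨v, .inr hv, hl⟩

theorem path_some_mu_iff {a b : ℕ} {t : Tm} {l : List ℕ} :
    Path x f (.mu b t) (some a) l ↔
      (b = a + 1 ∧ Path x f t none l) ∨ Path x f t (some (a + 1)) l := by
  simp only [Path, namedIn_mu_iff]
  constructor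
  · rintro ⟨v, ⟨hb, rfl⟩ | hv, hl⟩
    · exact .inl ⟨hb, hl⟩
    · exact .inr ⟨v, hv, hl⟩
  · rintro (⟨hb, hl⟩ | ⟨v, hv, hl⟩)
    · exact ⟨t, .inl ⟨hb, rfl⟩, hl⟩
    · exact ⟨v, .inr hv, hl⟩

/-- Extending the chain upwards never splits the path. One that reaches the top takes the name of
the next μ; one waiting at a μ-variable resumes when that variable is bound. Allowing the path to
end at a free name is what makes the induction go through. -/
theorem InN.exists_path {t : Tm} (h : InN x f t) :
    ∃ o l, Path x f t o l ∧ ∀ o' l', Path x f t o' l' → o' = o ∧ l' = l := by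
  induction h using InN.induction with
  | var =>
    refine ⟨none, [0], .last 0, ?_⟩
    rintro (_ | a) l h
    · exact ⟨rfl, readOff_var_iff.1 h⟩
    · obtain ⟨v, hv, -⟩ := h
      cases hv
  | app t _ ih =>
    obtain ⟨_ | a, l, hl, huniq⟩ := ih
    · obtain _ | ⟨i, l⟩ := l
      · exact (ReadOff.ne_nil hl rfl).elim
      refine ⟨none, (i + 1) :: l, readOff_app_iff.2 ⟨i, l, rfl, hl⟩, ?_⟩
      rintro (_ | a) l' h
      · obtain ⟨j, l', rfl, h'⟩ := readOff_app_iff.1 h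
        simpa using (huniq none _ h').2
      · obtain ⟨v, hv, h⟩ := h
        simp only [namedIn_app_iff, namedIn_var_iff, false_or] at hv
        cases (huniq (some a) _ ⟨v, hv, h⟩).1
    · obtain ⟨v, hv, hvl⟩ := hl
      refine ⟨some a, l, ⟨v, .appR _ hv, hvl⟩, ?_⟩
      rintro (_ | a) l' h
      · obtain ⟨j, l', rfl, h'⟩ := readOff_app_iff.1 h
        cases (huniq none _ h').1
      · obtain ⟨v, hv, h⟩ := h
        simp only [namedIn_app_iff, namedIn_var_iff, false_or] at hv
        exact huniq (some _) _ ⟨v, hv, h⟩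
  | mu b t _ _ ih =>
    obtain ⟨o, l, hl, huniq⟩ := ih
    -- Either the new μ captures the path, or the path waits at a name bound further out, whose
    -- index drops by one.
    have key : (((b = 0 ∧ o = none) ∨ o = some 0) ∧ ∀ a, ¬((b = a + 1 ∧ o = none) ∨ o = some (a + 1)))
        ∨ ∃ a, ((b = a + 1 ∧ o = none) ∨ o = some (a + 1)) ∧ ¬((b = 0 ∧ o = none) ∨ o = some 0) := by
      rcases o with _ | _ | a <;> rcases b with _ | b <;> simp
    have to_o : ∀ {c : ℕ} {l'}, (b = c ∧ Path x f t none l') ∨ Path x f t (some c) l' →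
        ((b = c ∧ o = none) ∨ o = some c) ∧ l' = l := by
      rintro c l' (⟨hb, h⟩ | h)
      · exact ⟨.inl ⟨hb, (huniq _ _ h).1.symm⟩, (huniq _ _ h).2⟩
      · exact ⟨.inr (huniq _ _ h).1.symm, (huniq _ _ h).2⟩
    have of_o : ∀ {c : ℕ}, ((b = c ∧ o = none) ∨ o = some c) →
        (b = c ∧ Path x f t none l) ∨ Path x f t (some c) l := by
      rintro c (⟨hb, rfl⟩ | rfl)
      · exact .inl ⟨hb, hl⟩
      · exact .inr hl
    rcases key with ⟨h0, h1⟩ | ⟨a, h1, h0⟩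
    · refine ⟨none, 0 :: l, path_none_mu_iff.2 ⟨l, rfl, of_o h0⟩, ?_⟩
      rintro (_ | a) l' h
      · obtain ⟨l', rfl, h'⟩ := path_none_mu_iff.1 h
        exact ⟨rfl, by rw [(to_o h').2]⟩
      · exact (h1 a (to_o (path_some_mu_iff.1 h)).1).elim
    · refine ⟨some a, l, path_some_mu_iff.2 (of_o h1), ?_⟩
      rintro (_ | a') l' h
      · obtain ⟨l', rfl, h'⟩ := path_none_mu_iff.1 h
        exact (h0 (to_o h').1).elim
      · have h := to_o (path_some_mu_iff.1 h)
        refine ⟨?_, h.2⟩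
        rcases h.1 with ⟨hb, ho⟩ | ho <;> rcases h1 with ⟨hb', ho'⟩ | ho' <;> simp_all

/-- A term of `N_{x,f}` without free `μ`-variables has exactly one read-off. -/
theorem InN.exists_readOff {t : Tm} (h : InN x f t) (hc : ∀ a, ¬ Tm.FreeMu a t) :
    ∃ l, ReadOff x f t l ∧ ∀ l', ReadOff x f t l' → l' = l := by
  obtain ⟨_ | a, l, hl, huniq⟩ := h.exists_path
  · exact ⟨l, hl, fun l' h' => (huniq none l' h').2⟩
  · obtain ⟨v, hv, -⟩ := hl
    exact (hc a hv.freeMu).elim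

variable {D : Type*} {z : D} {s : D → D}

/-- The bottoms with which a term of `N_{x,f}` is run tell what is read off. -/
theorem InN.path_sum {t : Tm} (h : InN 1 0 t) {δ : ℕ → D} {d : D}
    (hok : Ok z s (.clo t (envXF D) fun i => .atom (δ i)) (.atom d)) {o : Option ℕ} {l : List ℕ}
    (hl : Path 1 0 t o l) : o.elim d δ = s^[l.sum] z := by
  induction h using InN.induction generalizing δ d o l with
  | var =>
    cases o with
    | none =>
      obtain rfl := readOff_var_iff.1 hl
      cases ok_x_iff.1 (ok_var_iff.1 hok)
      rfl
    | some a =>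
      obtain ⟨v, hv, -⟩ := hl
      cases hv
  | app t _ ih =>
    obtain ⟨c, d', hp, hc⟩ := ok_f_iff.1 (ok_var_iff.1 (ok_app_iff.1 hok))
    cases hp
    cases o with
    | none =>
      obtain ⟨i, l, rfl, hl'⟩ := readOff_app_iff.1 hl
      have := ih hc (o := none) hl'
      simp only [List.sum_cons, Option.elim] at this ⊢
      rw [this, Nat.add_right_comm, Function.iterate_succ_apply']
    | some a =>
      obtain ⟨v, hv, hl⟩ := hl
      simp only [namedIn_app_iff, namedIn_var_iff, false_or] at hv
      exact ih hc (o := some a) ⟨v, hv, hl⟩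
  | mu b t _ _ ih =>
    rw [ok_mu_iff, scons_atom] at hok
    cases o with
    | none =>
      -- Both ways of being captured refer to index `0`, where the current bottom d is stored; the
      -- added entry `0` does not change the sum.
      obtain ⟨l, rfl, ⟨rfl, h⟩ | h⟩ := path_none_mu_iff.1 hl
      · simpa [scons] using ih hok h
      · simpa [scons] using ih hok h
    | some a =>
      obtain ⟨rfl, h⟩ | h := path_some_mu_iff.1 hl
      · exact ih hok h
      · exact ih hok h

end ReadOff

end LamMu

theorem mainTheorem1 (L : FirstOrder.Language.{u, v})
    (zero : L.Functions 0) (succ : L.Functions 1)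
    (E : Set (L.Term ℕ × L.Term ℕ)) (hE : LamMu.Adequate zero succ E)
    (θ : LamMu.Tm) (n : ℕ)
    (hθ : LamMu.IsClassicalInteger zero succ E n θ) (hnorm : LamMu.Normal θ) :
    ∃ t : LamMu.Tm,
      -- inside `λxλf`, the variable `x` has index `1` and `f` has index `0`
      θ = LamMu.Tm.lam (LamMu.Tm.lam t) ∧
      LamMu.InN 1 0 t ∧
      (∀ a, ¬ LamMu.Tm.FreeMu a t) ∧
      LamMu.val 1 0 t = {n} ∧
      ∃ l : List ℕ, LamMu.ReadOff 1 0 t l ∧ (∀ l', LamMu.ReadOff 1 0 t l' → l' = l) ∧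
        l.sum = n := by
  open LamMu in
  let z : TermModel E := Quotient.mk (eqSetoid E) (zeroT zero)
  -- The μ-environment is immaterial for a closed term, but its values must be bare bottoms for
  -- `Normal.inN` to apply later.
  have hok := hθ.ok fun _ => .atom z
  have hc := hθ.1.2
  obtain ⟨θ, rfl⟩ := hnorm.exists_lam (fun _ => True) (fun _ _ _ => trivial)
    (fun _ _ _ => not_ok_bad) hc trivial hok
  obtain ⟨c, q, hp, hok⟩ := ok_lam_iff.1 hok
  cases hp
  -- Only `x` can be executed now, and it rejects a stack on which the argument `f` is still
  -- waiting.
  obtain ⟨t, rfl⟩ := hnorm.of_lam.exists_lam (fun p => ∃ c q, p = .push c q)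
    (fun _ _ _ => ⟨_, _, rfl⟩) (by
      rintro (_ | i) _ ⟨c, q, rfl⟩
      · change ¬ Ok _ _ .x _
        simp [ok_x_iff]
      · exact not_ok_bad) hc ⟨_, _, rfl⟩ hok
  obtain ⟨c, q, hp, hok⟩ := ok_lam_iff.1 hok
  cases hp
  have hN : InN 1 0 t := hnorm.of_lam.of_lam.inN hok
  obtain ⟨l, hl, huniq⟩ := hN.exists_readOff hc
  -- The path reaching the top ends at the initial bottom, giving sⁿ(0) = s^k(0) with k the sum of
  -- l.
  have hsum : l.sum = n :=
    (TermModel.iterate_succ_injective hE (hN.path_sum hok (o := none) hl)).symm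
  refine ⟨t, rfl, hN, hc, ?_, l, hl, huniq, hsum⟩
  ext k
  refine hasVal_iff.trans ⟨?_, ?_⟩
  · rintro ⟨l', hl', rfl⟩
    rw [huniq l' hl']
    exact hsum
  · rintro rfl
    exact ⟨l, hl, hsum⟩
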